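/- Let $\mathbf{X}$ be a computable Polish space, i.e. a complete metric space $(X,d)$ with a dense sequence $(a_n)_{n\in\mathbb{N}}$ such that $(i,j)\mapsto d(a_i,a_j)$ is a computable double sequence of real numbers; its points, like real numbers, are named by rapidly converging sequences (of indices) of points of the dense sequence. Let $\mathcal{K}(\mathbf{X})$ be the represented space of compact subsets of $\mathbf{X}$, where $K$ is represented as the open set $\{U\in\mathcal{O}(\mathbf{X}) \mid K\subseteq U\}$ of the space $\mathcal{O}(\mathbf{X})$ of open subsets. Write $B(x,r)$ and $\overline{B}(x,r)$ for the open and the closed ball. Then the partial multivalued map $$\operatorname{NiceRadius} :\subseteq \mathbf{X}\times\mathbb{R}^{>0}\times\mathcal{K}(\mathbf{X})\rightrightarrows\mathbb{R},$$ with $(x,r,K)\in\operatorname{dom}(\operatorname{NiceRadius})$ iff $K=\overline{B}(x,r)$, and with $r'\in\operatorname{NiceRadius}(x,r,K)$ iff $0<r'<r$ and $\mathrm{cl}\,B(x,r')=\overline{B}(x,r')$, is computable: there is a single oracle machine that transforms every name of every $(x,r,K)$ in the domain into a name of some $r'\in\operatorname{NiceRadius}(x,r,K)$. -/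

import Mathlib

universe u v

namespace CompAnalysis

/-- Partial functionals `Φ : (ℕ → ℕ) → ℕ →. ℕ` computed by a single oracle machine: `Φ p n` is the
result of the machine run on input `n` with oracle `p`. These are the partial recursive
functions, generated uniformly in the oracle `p`. -/
inductive OracleComputable : ((ℕ → ℕ) → ℕ →. ℕ) → Prop
  | zero : OracleComputable fun _ _ => Part.some 0
  | succ : OracleComputable fun _ n => Part.some (n + 1)
  | left : OracleComputable fun _ n => Part.some (Nat.unpair n).1
  | right : OracleComputable fun _ n => Part.some (Nat.unpair n).2
  | oracle : OracleComputable fun p n => Part.some (p n)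
  | pair {f h : (ℕ → ℕ) → ℕ →. ℕ} (hf : OracleComputable f) (hh : OracleComputable h) :
      OracleComputable fun p n => (f p n).bind fun a => (h p n).map fun b => Nat.pair a b
  | comp {f h : (ℕ → ℕ) → ℕ →. ℕ} (hf : OracleComputable f) (hh : OracleComputable h) :
      OracleComputable fun p n => (h p n).bind (f p)
  | prec {f h : (ℕ → ℕ) → ℕ →. ℕ} (hf : OracleComputable f) (hh : OracleComputable h) :
      OracleComputable fun p n =>
        Nat.rec (motive := fun _ => Part ℕ) (f p (Nat.unpair n).1)
          (fun y IH => IH.bind fun i => h p (Nat.pair (Nat.unpair n).1 (Nat.pair y i)))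
          (Nat.unpair n).2
  | rfind {f : (ℕ → ℕ) → ℕ →. ℕ} (hf : OracleComputable f) :
      OracleComputable fun p n =>
        Nat.rfind fun m => (f p (Nat.pair n m)).map fun b => decide (b = 0)

/-- A represented space: a set `X` with a partial surjection from Baire space `ℕ → ℕ` onto `X`,
given here by its graph: `IsName p x` says that `p` is a name of `x`. -/
class RepresentedSpace (X : Type u) where
  IsName : (ℕ → ℕ) → X → Prop
  unique : ∀ {p x y}, IsName p x → IsName p y → x = y
  exists_name : ∀ x, ∃ p, IsName p x

open RepresentedSpace

/-- A partial multivalued map from `X` to `Y`, with explicitly given domain; `rel x y` says that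
`y` is an admissible value at `x`. -/
structure MultiMap (X : Type u) (Y : Type v) where
  dom : Set X
  rel : X → Y → Prop

/-- A partial multivalued map is computable if some oracle machine turns every name of every point
`x` of the domain into a name of some admissible value at `x`. -/
def MultiMap.IsComputable {X : Type u} {Y : Type v} [RepresentedSpace X] [RepresentedSpace Y]
    (F : MultiMap X Y) : Prop :=
  ∃ Φ : (ℕ → ℕ) → ℕ →. ℕ, OracleComputable Φ ∧
    ∀ x ∈ F.dom, ∀ p, IsName p x →
      ∃ (q : ℕ → ℕ) (y : Y), (∀ n, q n ∈ Φ p n) ∧ IsName q y ∧ F.rel x y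

/-- Products: a name of `(x, y)` interleaves a name of `x` and a name of `y`. -/
instance instProd {X : Type u} {Y : Type v} [RepresentedSpace X] [RepresentedSpace Y] :
    RepresentedSpace (X × Y) where
  IsName p z := IsName (fun n => p (2 * n)) z.1 ∧ IsName (fun n => p (2 * n + 1)) z.2
  unique h h' := Prod.ext (unique h.1 h'.1) (unique h.2 h'.2)
  exists_name z := by
    obtain ⟨p, hp⟩ := exists_name z.1
    obtain ⟨q, hq⟩ := exists_name z.2
    refine ⟨fun n => if n % 2 = 0 then p (n / 2) else q (n / 2), ?_, ?_⟩
    · have : (fun n => if (2 * n) % 2 = 0 then p (2 * n / 2) else q (2 * n / 2)) = p := by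
        funext n; simp
      simpa only [this] using hp
    · have : (fun n => if (2 * n + 1) % 2 = 0 then p ((2 * n + 1) / 2)
          else q ((2 * n + 1) / 2)) = q := by
        funext n
        rw [if_neg (by omega), show (2 * n + 1) / 2 = n by omega]
      simpa only [this] using hq

/-- Subspaces: names are inherited. -/
instance instSubtype {X : Type u} [RepresentedSpace X] {P : X → Prop} :
    RepresentedSpace {x : X // P x} where
  IsName p x := IsName p x.1
  unique h h' := Subtype.ext (unique h h')
  exists_name x := exists_name x.1

/-- The Cauchy representation of a metric space with a dense sequence `a`: a name of `x` is a
sequence of indices of points converging rapidly to `x`. -/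
@[reducible] def cauchyRep {X : Type u} [MetricSpace X] (a : ℕ → X) (ha : DenseRange a) :
    RepresentedSpace X where
  IsName p x := ∀ k, dist (a (p k)) x < (1 / 2 : ℝ) ^ k
  unique {p x y} hx hy := by
    have key : ∀ z, (∀ k, dist (a (p k)) z < (1 / 2 : ℝ) ^ k) →
        Filter.Tendsto (fun k => a (p k)) Filter.atTop (nhds z) := fun z hz =>
      tendsto_iff_dist_tendsto_zero.2 <| squeeze_zero (fun _ => dist_nonneg)
        (fun k => (hz k).le)
        (tendsto_pow_atTop_nhds_zero_of_lt_one (by norm_num) (by norm_num))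
    exact tendsto_nhds_unique (key x hx) (key y hy)
  exists_name x := by
    choose p hp using fun k : ℕ =>
      ha.exists_dist_lt x (show (0 : ℝ) < (1 / 2 : ℝ) ^ k by positivity)
    exact ⟨p, fun k => by rw [dist_comm]; exact hp k⟩

/-- The standard effective enumeration of the rational numbers. -/
noncomputable def ratSeq (n : ℕ) : ℝ :=
  ((n.unpair.1 : ℝ) - n.unpair.2.unpair.1) / (n.unpair.2.unpair.2 + 1)

theorem denseRange_ratSeq : DenseRange ratSeq := by
  refine Rat.denseRange_cast (𝕜 := ℝ) |>.mono ?_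
  rintro _ ⟨q, rfl⟩
  refine ⟨Nat.pair q.num.toNat (Nat.pair (-q.num).toNat (q.den - 1)), ?_⟩
  have h1 : ((q.den - 1 : ℕ) : ℝ) + 1 = q.den := by
    have := q.den_pos
    exact_mod_cast Nat.sub_add_cancel this
  have h2 : ((q.num.toNat : ℕ) : ℝ) - ((-q.num).toNat : ℕ) = q.num := by
    exact_mod_cast Int.toNat_sub_toNat_neg q.num
  simp only [ratSeq, Nat.unpair_pair, h1, h2]
  exact (Rat.cast_def q).symm

/-- The real numbers, named by rapidly converging sequences of rationals. -/
noncomputable instance instReal : RepresentedSpace ℝ := cauchyRep ratSeq denseRange_ratSeq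

/-- The word consisting of the first `k` values of `p`. -/
def word (p : ℕ → ℕ) (k : ℕ) : List ℕ := (List.range k).map p

/-- `q` is a name of the open set `U`: it lists words `w` (as `encode w + 1`, while `0` lists
nothing), and a name `p` of a point has a listed prefix exactly if the point belongs to `U`. -/
def IsOpenName {X : Type u} [RepresentedSpace X] (q : ℕ → ℕ) (U : Set X) : Prop :=
  ∀ p x, IsName p x → (x ∈ U ↔ ∃ n k, q n = Encodable.encode (word p k) + 1)

/-- The space `𝒪(X)` of open subsets of a represented space, i.e. of those sets the preimage of
which under the representation is relatively open. -/
def OpenSets (X : Type u) [RepresentedSpace X] : Type u :=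
  {U : Set X // ∃ q, IsOpenName q U}

instance instOpenSets {X : Type u} [RepresentedSpace X] : RepresentedSpace (OpenSets X) where
  IsName q U := IsOpenName q U.1
  unique {q U V} hU hV := by
    refine Subtype.ext (Set.ext fun x => ?_)
    obtain ⟨p, hp⟩ := exists_name x
    exact (hU p x hp).trans (hV p x hp).symm
  exists_name U := U.2

/-- The open neighbourhoods of a set, as a subset of `𝒪(X)`. -/
def nbhds {X : Type u} [RepresentedSpace X] (K : Set X) : Set (OpenSets X) :=
  {U | K ⊆ U.1}

/-- The space `𝒦(X)` of (saturated) compact subsets of `X`, as a subspace of `𝒪(𝒪(X))`: a set `K`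
is compact if its open neighbourhoods form an open subset of `𝒪(X)`. In a T1 space every
set is saturated. -/
def CompactSets (X : Type u) [RepresentedSpace X] : Type u :=
  {K : Set X // (∀ x, (∀ U ∈ nbhds K, x ∈ U.1) → x ∈ K) ∧ ∃ q, IsOpenName q (nbhds K)}

instance instCompactSets {X : Type u} [RepresentedSpace X] :
    RepresentedSpace (CompactSets X) where
  IsName q K := IsOpenName q (nbhds K.1)
  unique {q K L} hK hL := by
    have h : nbhds K.1 = nbhds L.1 := Set.ext fun U => by
      obtain ⟨p, hp⟩ := exists_name U
      exact (hK p U hp).trans (hL p U hp).symm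
    refine Subtype.ext (Set.Subset.antisymm ?_ ?_)
    · exact fun x hx => L.2.1 x fun U hU => by rw [← h] at hU; exact hU hx
    · exact fun x hx => K.2.1 x fun U hU => by rw [h] at hU; exact hU hx
  exists_name K := K.2.2

/-- A computable metric space: a metric space with a fixed dense sequence such that
`(i, j) ↦ d(aᵢ, aⱼ)` is a computable double sequence of reals. Complete computable
metric spaces are the computable Polish spaces. -/
class ComputableMetricSpace (X : Type u) [MetricSpace X] where
  pt : ℕ → X
  dense : DenseRange pt
  computable_dist : ∃ f : ℕ × ℕ × ℕ → ℕ, Computable f ∧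
    ∀ i j, IsName (fun k => f (i, j, k)) (dist (pt i) (pt j))

instance instCauchy {X : Type u} [MetricSpace X] [ComputableMetricSpace X] :
    RepresentedSpace X :=
  cauchyRep (ComputableMetricSpace.pt : ℕ → X) ComputableMetricSpace.dense

/-- The partial multivalued map `NiceRadius :⊆ X × ℝ^{>0} × 𝒦(X) ⇉ ℝ`. -/
def niceRadius (X : Type u) [MetricSpace X] [ComputableMetricSpace X] :
    MultiMap (X × {r : ℝ // 0 < r} × CompactSets X) ℝ where
  dom := {t | t.2.2.1 = Metric.closedBall t.1 t.2.1.1}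
  rel t r' := 0 < r' ∧ r' < t.2.1.1 ∧
    closure (Metric.ball t.1 r') = Metric.closedBall t.1 r'

end CompAnalysis

/-! ### Computability uniform in an oracle -/

namespace CompAnalysis
open Encodable

/-! The radius is found by trisecting intervals while diagonalising over all pairs `(i, k)`, that
is, over the balls of radius `2⁻ᵏ` around the dense points `aᵢ`. It suffices that for each pair
either some dense point of the open ball `B(x, s)` is within `2 · 2⁻ᵏ` of `aᵢ`, or the sphere of
radius `s` misses the closed ball around `aᵢ`; this is `closure_ball_eq_closedBall_of_dense`.

Let the current interval have inner division points `u < v`. If some dense point is near `aᵢ` and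
closer to `x` than `v`, moving to the right third secures the first alternative for every later `s`.
If each point of `K` is far from `aᵢ` or farther than `u` from `x`, moving to the left third secures
the second, because `K` is the closed ball of radius `r > s` and so contains the sphere. The first
condition is semidecidable by searching dense points. The second asks whether `K` is contained in an
open set named uniformly in the data (`isOpenName_farName`), which a name of `K` semidecides
(`subset_farSet_iff`). Since `u < v`, at least one condition holds, so the parallel search
terminates (`exists_stageTest`). The nested intervals shrink to `s`, and their left ends name it. -/

theorem OracleComputable.of_partrec {f : ℕ →. ℕ} (hf : Nat.Partrec f) :
    OracleComputable fun _ => f := by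
  induction hf with
  | zero => exact .zero
  | succ => exact .succ
  | left => exact .left
  | right => exact .right
  | pair _ _ h1 h2 =>
    convert OracleComputable.pair h1 h2 using 3
    simp [Seq.seq, Part.bind_map]
  | comp _ _ h1 h2 => exact OracleComputable.comp h1 h2
  | prec _ _ h1 h2 => exact OracleComputable.prec h1 h2
  | rfind _ h1 => exact OracleComputable.rfind h1

/-- Partial functions between countable types, computable uniformly in an oracle. -/
def RelPartrec {α σ : Type*} [Primcodable α] [Primcodable σ]
    (F : (ℕ → ℕ) → α →. σ) : Prop :=
  ∃ G : (ℕ → ℕ) → ℕ →. ℕ, OracleComputable G ∧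
    ∀ p a, G p (encode a) = (F p a).map encode

/-- Total functions between countable types, computable uniformly in an oracle. -/
def RelComputable {α σ : Type*} [Primcodable α] [Primcodable σ]
    (F : (ℕ → ℕ) → α → σ) : Prop :=
  RelPartrec fun p a => Part.some (F p a)

section
variable {α β γ σ : Type*} [Primcodable α] [Primcodable β] [Primcodable γ] [Primcodable σ]

theorem RelPartrec.oracleComputable {F : (ℕ → ℕ) → ℕ →. ℕ} (h : RelPartrec F) :
    OracleComputable F := by
  obtain ⟨G, hG, h⟩ := h
  convert hG using 1
  funext p n
  exact ((h p n).trans (Part.map_id' (fun _ => rfl) _)).symm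

theorem _root_.Computable.relComputable {f : α → σ} (hf : Computable f) :
    RelComputable fun _ => f := by
  -- The code of `some b` is the code of `b` plus one; the predecessor removes the shift.
  have h : Computable fun n : ℕ => (encode ((decode (α := α) n).map f)).pred :=
    Computable.pred.comp <| Computable.encode.comp <|
      Computable.option_map Computable.decode (hf.comp Computable.snd)
  refine ⟨_, .of_partrec (Partrec.nat_iff.1 h.partrec), fun p a => ?_⟩
  simp

theorem _root_.Primrec.relComputable {f : α → σ} (hf : Primrec f) :
    RelComputable fun _ => f := hf.to_comp.relComputable

theorem RelComputable.oracle : RelComputable fun p (n : ℕ) => p n :=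
  ⟨_, .oracle, fun p a => by simp⟩

theorem RelPartrec.comp {F : (ℕ → ℕ) → β →. σ} {H : (ℕ → ℕ) → α → β}
    (hF : RelPartrec F) (hH : RelComputable H) : RelPartrec fun p a => F p (H p a) := by
  obtain ⟨G, hG, h⟩ := hF
  obtain ⟨G', hG', h'⟩ := hH
  refine ⟨_, .comp hG hG', fun p a => ?_⟩
  rw [h', Part.map_some]
  exact (Part.bind_some _ _).trans (h _ _)

theorem RelComputable.comp {F : (ℕ → ℕ) → β → σ} {H : (ℕ → ℕ) → α → β}
    (hF : RelComputable F) (hH : RelComputable H) : RelComputable fun p a => F p (H p a) :=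
  RelPartrec.comp (F := fun p b => Part.some (F p b)) hF hH

theorem RelComputable.pair {F : (ℕ → ℕ) → α → β} {H : (ℕ → ℕ) → α → γ}
    (hF : RelComputable F) (hH : RelComputable H) :
    RelComputable fun p a => (F p a, H p a) := by
  obtain ⟨G, hG, h⟩ := hF
  obtain ⟨G', hG', h'⟩ := hH
  refine ⟨_, .pair hG hG', fun p a => ?_⟩
  simp [h, h']

theorem RelPartrec.bind {F : (ℕ → ℕ) → α →. β} {H : (ℕ → ℕ) → α × β →. σ}
    (hF : RelPartrec F) (hH : RelPartrec H) :
    RelPartrec fun p a => (F p a).bind fun b => H p (a, b) := by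
  obtain ⟨G, hG, h⟩ := hF
  obtain ⟨G', hG', h'⟩ := hH
  have hid : OracleComputable fun _ n => Part.some n :=
    .of_partrec Nat.Partrec.some
  refine ⟨_, .comp hG' (.pair hid hG), fun p a => ?_⟩
  simp only [Part.bind_some, h, Part.map_map, Part.map_bind]
  refine (Part.bind_map _ _ _).trans ?_
  congr 1
  funext b
  exact h' p (a, b)

theorem RelPartrec.map {F : (ℕ → ℕ) → α →. β} {H : (ℕ → ℕ) → α × β → σ}
    (hF : RelPartrec F) (hH : RelComputable H) :
    RelPartrec fun p a => (F p a).map fun b => H p (a, b) := by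
  have := hF.bind hH
  simp only [Part.bind_some_eq_map] at this
  exact this

theorem RelPartrec.nat_rec {F : (ℕ → ℕ) → α →. σ} {H : (ℕ → ℕ) → α × ℕ × σ →. σ}
    (hF : RelPartrec F) (hH : RelPartrec H) :
    RelPartrec fun p (z : α × ℕ) => Nat.rec (motive := fun _ => Part σ) (F p z.1)
      (fun y IH => IH.bind fun i => H p (z.1, y, i)) z.2 := by
  obtain ⟨G, hG, h⟩ := hF
  obtain ⟨G', hG', h'⟩ := hH
  refine ⟨_, .prec hG hG', ?_⟩
  rintro p ⟨a, n⟩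
  simp only [encode_prod_val, Nat.unpair_pair, encode_nat]
  induction n with
  | zero => exact h p a
  | succ n ih =>
    simp only [ih, Part.bind_map, Part.map_bind]
    congr 1
    funext b
    have := h' p (a, n, b)
    simpa using this

theorem RelComputable.nat_rec {F : (ℕ → ℕ) → α → σ} {H : (ℕ → ℕ) → α × ℕ × σ → σ}
    (hF : RelComputable F) (hH : RelComputable H) :
    RelComputable fun p (z : α × ℕ) => Nat.rec (motive := fun _ => σ) (F p z.1)
      (fun y i => H p (z.1, y, i)) z.2 := by
  have := RelPartrec.nat_rec hF hH
  refine (congrArg RelPartrec ?_).mp this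
  funext p ⟨a, n⟩
  induction n with
  | zero => rfl
  | succ n ih => exact (congrArg (Part.bind · _) ih).trans (Part.bind_some _ _)

theorem RelPartrec.rfind {T : (ℕ → ℕ) → α × ℕ → Bool} (hT : RelComputable T) :
    RelPartrec fun p a => Nat.rfind fun m => Part.some (T p (a, m)) := by
  -- The oracle machine's search stops at the value 0, so success has to be coded by 0.
  have hn : RelComputable fun p z => encode (!T p z) :=
    (Primrec.encode.comp Primrec.not).relComputable.comp hT
  obtain ⟨G, hG, h⟩ := hn
  refine ⟨_, .rfind hG, fun p a => ?_⟩
  have : ∀ m, (G p (Nat.pair (encode a) m)).map (fun b => decide (b = 0)) =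
      Part.some (T p (a, m)) := fun m => by
    have := h p (a, m)
    simp only [encode_prod_val, encode_nat] at this
    rw [this]
    cases T p (a, m) <;> simp
  simp only [this]
  exact (Part.map_id' (fun _ => rfl) _).symm

theorem RelComputable.of_eq {F H : (ℕ → ℕ) → α → σ} (hF : RelComputable F)
    (h : ∀ p a, F p a = H p a) : RelComputable H :=
  (funext fun p => funext (h p) : F = H) ▸ hF

theorem RelComputable.const (c : σ) : RelComputable fun _ (_ : α) => c :=
  (Primrec.const c).relComputable

theorem _root_.Primrec₂.relComputable {f : β → γ → σ} (hf : Primrec₂ f)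
    {F : (ℕ → ℕ) → α → β} {H : (ℕ → ℕ) → α → γ}
    (hF : RelComputable F) (hH : RelComputable H) :
    RelComputable fun p a => f (F p a) (H p a) :=
  (Primrec.relComputable (f := fun z : β × γ => f z.1 z.2) hf).comp (hF.pair hH)

/-- Words over a uniformly computable sequence are uniformly computable. -/
theorem RelComputable.word {q : (ℕ → ℕ) → α × ℕ → ℕ} (hq : RelComputable q) :
    RelComputable fun p (z : α × ℕ) => word (fun j => q p (z.1, j)) z.2 := by
  have hz : RelComputable fun _ (z : α × ℕ × List ℕ) => (z.1, z.2.1) :=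
    (Primrec.fst.pair (Primrec.fst.comp Primrec.snd)).relComputable
  have hl : RelComputable fun _ (z : α × ℕ × List ℕ) => z.2.2 :=
    (Primrec.snd.comp Primrec.snd).relComputable
  refine (RelComputable.nat_rec (.const (α := α) ([] : List ℕ))
    (Primrec.list_concat.relComputable hl (hq.comp hz))).of_eq fun p z => ?_
  induction z.2 with
  | zero => rfl
  | succ n ih => simp [ih, CompAnalysis.word, List.range_succ]

end
end CompAnalysis

/-! ### Rational comparisons and the trisection machine -/

namespace CompAnalysis
open Encodable

/-- Decides `N / M + N' / M' < ratSeq u`. -/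
def ratGT (u N M N' M' : ℕ) : Bool :=
  decide (u.unpair.2.unpair.1 * (M * M') + (u.unpair.2.unpair.2 + 1) * (N * M' + N' * M)
    < u.unpair.1 * (M * M'))

/-- Decides `ratSeq u + N / M < N' / M'`. -/
def ratLT (u N M N' M' : ℕ) : Bool :=
  decide (u.unpair.1 * (M * M') + (u.unpair.2.unpair.2 + 1) * (N * M')
    < u.unpair.2.unpair.1 * (M * M') + (u.unpair.2.unpair.2 + 1) * (N' * M))

theorem ratGT_iff {u N M N' M' : ℕ} (hM : 0 < M) (hM' : 0 < M') :
    ratGT u N M N' M' = true ↔ (N : ℝ) / M + N' / M' < ratSeq u := by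
  have h1 : (0 : ℝ) < M := by exact_mod_cast hM
  have h2 : (0 : ℝ) < M' := by exact_mod_cast hM'
  have h3 : (0 : ℝ) < (u.unpair.2.unpair.2 : ℝ) + 1 := by positivity
  rw [ratGT, decide_eq_true_iff, ratSeq, div_add_div _ _ h1.ne' h2.ne',
    div_lt_div_iff₀ (by positivity) h3, ← @Nat.cast_lt ℝ]
  push_cast
  constructor <;> intro h <;> linarith

theorem ratLT_iff {u N M N' M' : ℕ} (hM : 0 < M) (hM' : 0 < M') :
    ratLT u N M N' M' = true ↔ ratSeq u + (N : ℝ) / M < N' / M' := by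
  have h1 : (0 : ℝ) < M := by exact_mod_cast hM
  have h2 : (0 : ℝ) < M' := by exact_mod_cast hM'
  have h3 : (0 : ℝ) < (u.unpair.2.unpair.2 : ℝ) + 1 := by positivity
  rw [ratLT, decide_eq_true_iff, ratSeq, div_add_div _ _ h3.ne' h1.ne',
    div_lt_div_iff₀ (by positivity) h2, ← @Nat.cast_lt ℝ]
  push_cast
  constructor <;> intro h <;> linarith

section
variable {α : Type*} [Primcodable α]

theorem RelComputable.add {F H : (ℕ → ℕ) → α → ℕ} (hF : RelComputable F)
    (hH : RelComputable H) : RelComputable fun p a => F p a + H p a :=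
  Primrec.nat_add.relComputable hF hH

theorem RelComputable.mul {F H : (ℕ → ℕ) → α → ℕ} (hF : RelComputable F)
    (hH : RelComputable H) : RelComputable fun p a => F p a * H p a :=
  Primrec.nat_mul.relComputable hF hH

theorem RelComputable.pow {F H : (ℕ → ℕ) → α → ℕ} (hF : RelComputable F)
    (hH : RelComputable H) : RelComputable fun p a => F p a ^ H p a :=
  Primrec₂.relComputable (Primrec₂.unpaired'.1 Nat.Primrec.pow) hF hH

theorem RelComputable.lt {F H : (ℕ → ℕ) → α → ℕ} (hF : RelComputable F)
    (hH : RelComputable H) : RelComputable fun p a => decide (F p a < H p a) :=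
  Primrec₂.relComputable Primrec.nat_lt.decide hF hH

theorem RelComputable.eq {F H : (ℕ → ℕ) → α → ℕ} (hF : RelComputable F)
    (hH : RelComputable H) : RelComputable fun p a => decide (F p a = H p a) :=
  Primrec₂.relComputable Primrec.eq.decide hF hH

theorem RelComputable.and {F H : (ℕ → ℕ) → α → Bool} (hF : RelComputable F)
    (hH : RelComputable H) : RelComputable fun p a => F p a && H p a :=
  Primrec.and.relComputable hF hH

theorem RelComputable.or {F H : (ℕ → ℕ) → α → Bool} (hF : RelComputable F)
    (hH : RelComputable H) : RelComputable fun p a => F p a || H p a :=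
  Primrec.or.relComputable hF hH

theorem RelComputable.cond {C : (ℕ → ℕ) → α → Bool} {F H : (ℕ → ℕ) → α → ℕ}
    (hC : RelComputable C) (hF : RelComputable F) (hH : RelComputable H) :
    RelComputable fun p a => bif C p a then F p a else H p a :=
  (Primrec.relComputable (f := fun z : Bool × ℕ × ℕ => bif z.1 then z.2.1 else z.2.2)
    (Primrec.cond Primrec.fst (Primrec.fst.comp Primrec.snd)
      (Primrec.snd.comp Primrec.snd))).comp (hC.pair (hF.pair hH))

theorem RelComputable.unpair_fst {F : (ℕ → ℕ) → α → ℕ} (hF : RelComputable F) :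
    RelComputable fun p a => (F p a).unpair.1 :=
  (Primrec.fst.comp Primrec.unpair).relComputable.comp hF

theorem RelComputable.unpair_snd {F : (ℕ → ℕ) → α → ℕ} (hF : RelComputable F) :
    RelComputable fun p a => (F p a).unpair.2 :=
  (Primrec.snd.comp Primrec.unpair).relComputable.comp hF

theorem RelComputable.ratGT {U N M N' M' : (ℕ → ℕ) → α → ℕ} (hU : RelComputable U)
    (hN : RelComputable N) (hM : RelComputable M) (hN' : RelComputable N')
    (hM' : RelComputable M') :
    RelComputable fun p a => ratGT (U p a) (N p a) (M p a) (N' p a) (M' p a) :=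
  .lt (.add (.mul hU.unpair_snd.unpair_fst (hM.mul hM'))
    (.mul (hU.unpair_snd.unpair_snd.add (.const 1)) ((hN.mul hM').add (hN'.mul hM))))
    (hU.unpair_fst.mul (hM.mul hM'))

theorem RelComputable.ratLT {U N M N' M' : (ℕ → ℕ) → α → ℕ} (hU : RelComputable U)
    (hN : RelComputable N) (hM : RelComputable M) (hN' : RelComputable N')
    (hM' : RelComputable M') :
    RelComputable fun p a => ratLT (U p a) (N p a) (M p a) (N' p a) (M' p a) :=
  .lt (.add (hU.unpair_fst.mul (hM.mul hM'))
      (.mul (hU.unpair_snd.unpair_snd.add (.const 1)) (hN.mul hM')))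
    (.add (.mul hU.unpair_snd.unpair_fst (hM.mul hM'))
      (.mul (hU.unpair_snd.unpair_snd.add (.const 1)) (hN'.mul hM)))

end

section
variable (f : ℕ × ℕ × ℕ → ℕ)

/-- The common denominator of the interval ends at stage `t`, for a start interval of
length `2⁻ᵉ / 3`. -/
def stageDenom (e t : ℕ) : ℕ := 2 ^ e * 3 ^ (t + 1)

/-- With `z = ((e, t, A), b, l)` and `t` coding `(i, k)`: certifies that every point closer than
`2⁻ˡ` to the `b`-th dense point has distance over `2⁻ᵏ` from the `i`-th one or lies outside the
inner third of the interval around the centre. -/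
def farTest (p : ℕ → ℕ) (z : (ℕ × ℕ × ℕ) × ℕ × ℕ) : Bool :=
  ratGT (f (z.2.1, z.1.2.1.unpair.1, z.2.2)) 1 (2 ^ z.1.2.1.unpair.2) 3 (2 ^ z.2.2) ||
  ratGT (f (z.2.1, p (2 * z.2.2), z.2.2)) (3 * z.1.2.2 + 1) (3 * stageDenom z.1.1 z.1.2.1)
    3 (2 ^ z.2.2)

/-- With `z = ((e, t, A), j, l)`: certifies at precision `2⁻ˡ` that the `j`-th dense point is
closer than `2 * 2⁻ᵏ` to the `i`-th one and within the second third of the interval. -/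
def nearTest (p : ℕ → ℕ) (z : (ℕ × ℕ × ℕ) × ℕ × ℕ) : Bool :=
  ratLT (f (z.2.1, z.1.2.1.unpair.1, z.2.2)) 1 (2 ^ z.2.2) 2 (2 ^ z.1.2.1.unpair.2) &&
  ratLT (f (z.2.1, p (2 * z.2.2), z.2.2)) 2 (2 ^ z.2.2)
    (3 * z.1.2.2 + 2) (3 * stageDenom z.1.1 z.1.2.1)

/-- A name of the open set whose points are certified by `farTest`. -/
def farName (p : ℕ → ℕ) (z : (ℕ × ℕ × ℕ) × ℕ) : ℕ :=
  bif decide (0 < (Denumerable.ofNat (List ℕ) z.2).length) &&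
    farTest f p (z.1, (Denumerable.ofNat (List ℕ) z.2).getI
      ((Denumerable.ofNat (List ℕ) z.2).length - 1),
      (Denumerable.ofNat (List ℕ) z.2).length - 1)
  then z.2 + 1 else 0

/-- Certifies that the set coded in the oracle is contained in the open set with name
`farName`. -/
def coverTest (p : ℕ → ℕ) (z : (ℕ × ℕ × ℕ) × ℕ × ℕ) : Bool :=
  decide (p (4 * z.2.1 + 3) = encode (word (fun j => farName f p (z.1, j)) z.2.2) + 1)

/-- Certifies a choice of the next interval. -/
def stageTest (p : ℕ → ℕ) (z : (ℕ × ℕ × ℕ) × ℕ) : Bool :=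
  nearTest f p (z.1, z.2.unpair) || coverTest f p (z.1, z.2.unpair)

/-- The left end of the next interval, as a multiple of the reciprocal of the denominator. -/
def stageNext (p : ℕ → ℕ) (z : (ℕ × ℕ × ℕ) × ℕ) : ℕ :=
  bif nearTest f p (z.1, z.2.unpair) then 3 * z.1.2.2 + 2 else 3 * z.1.2.2

/-- One step of the interval recursion. -/
def stageStep (p : ℕ → ℕ) (z : ℕ × ℕ × ℕ) : Part ℕ :=
  (Nat.rfind fun m => Part.some (stageTest f p (z, m))).map fun m => stageNext f p (z, m)

/-- The left end of the interval at stage `z.2`. -/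
def stage (p : ℕ → ℕ) (z : ℕ × ℕ) : Part ℕ :=
  Nat.rec (motive := fun _ => Part ℕ) (Part.some 1)
    (fun t IH => IH.bind fun A => stageStep f p (z.1, t, A)) z.2

/-- Certifies `2⁻ⁿ < r` for the radius `r` coded in the oracle. -/
def startTest (p : ℕ → ℕ) (z : ℕ × ℕ) : Bool :=
  ratGT (p (4 * z.2 + 1)) 1 (2 ^ z.2) 1 (2 ^ z.2)

/-- Some `e` with `2⁻ᵉ` below the radius coded in the oracle. -/
def start (p : ℕ → ℕ) (n : ℕ) : Part ℕ :=
  Nat.rfind fun m => Part.some (startTest p (n, m))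

/-- The index of the left end of the `n`-th interval. -/
def stageIndex (z : (ℕ × ℕ) × ℕ) : ℕ :=
  -- `ratSeq` adds one to the last component, hence the subtraction.
  Nat.pair z.2 (Nat.pair 0 (stageDenom z.1.1 z.1.2 - 1))

/-- The machine computing a nice radius. -/
def niceRadiusMachine (p : ℕ → ℕ) : ℕ →. ℕ := fun n =>
  (start p n).bind fun e => (stage f p (e, n)).map fun A => stageIndex ((e, n), A)

theorem RelComputable.stageDenom {α : Type*} [Primcodable α] {F H : (ℕ → ℕ) → α → ℕ}
    (hF : RelComputable F) (hH : RelComputable H) :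
    RelComputable fun p a => stageDenom (F p a) (H p a) :=
  .mul (.pow (.const 2) hF) (.pow (.const 3) (hH.add (.const 1)))

theorem RelComputable.id {α : Type*} [Primcodable α] : RelComputable fun _ (a : α) => a :=
  Primrec.id.relComputable

section
variable {α β γ : Type*} [Primcodable α] [Primcodable β] [Primcodable γ]
theorem RelComputable.fst {F : (ℕ → ℕ) → α → β × γ} (hF : RelComputable F) :
    RelComputable fun p a => (F p a).1 :=
  Primrec.fst.relComputable.comp hF

theorem RelComputable.snd {F : (ℕ → ℕ) → α → β × γ} (hF : RelComputable F) :
    RelComputable fun p a => (F p a).2 :=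
  Primrec.snd.relComputable.comp hF
end

variable {f}

theorem relComputable_farTest (hf : Computable f) : RelComputable (farTest f) := by
  have hz : RelComputable fun _ (z : (ℕ × ℕ × ℕ) × ℕ × ℕ) => z := .id
  have hi := hz.fst.snd.fst.unpair_fst
  have hk := hz.fst.snd.fst.unpair_snd
  have hA := hz.fst.snd.snd
  have hb := hz.snd.fst
  have hl := hz.snd.snd
  have h2 {F : (ℕ → ℕ) → (ℕ × ℕ × ℕ) × ℕ × ℕ → ℕ} (h : RelComputable F) :
    RelComputable fun p z => 2 ^ F p z := .pow (.const 2) h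
  exact .or (.ratGT (hf.relComputable.comp (hb.pair (hi.pair hl))) (.const 1) (h2 hk) (.const 3)
      (h2 hl))
    (.ratGT (hf.relComputable.comp (hb.pair (.pair (.comp .oracle (.mul (.const 2) hl)) hl)))
      (.add (.mul (.const 3) hA) (.const 1))
      (.mul (.const 3) (.stageDenom hz.fst.fst hz.fst.snd.fst)) (.const 3) (h2 hl))

theorem relComputable_nearTest (hf : Computable f) : RelComputable (nearTest f) := by
  have hz : RelComputable fun _ (z : (ℕ × ℕ × ℕ) × ℕ × ℕ) => z := .id
  have hi := hz.fst.snd.fst.unpair_fst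
  have hk := hz.fst.snd.fst.unpair_snd
  have hA := hz.fst.snd.snd
  have hb := hz.snd.fst
  have hl := hz.snd.snd
  have h2 {F : (ℕ → ℕ) → (ℕ × ℕ × ℕ) × ℕ × ℕ → ℕ} (h : RelComputable F) :
    RelComputable fun p z => 2 ^ F p z := .pow (.const 2) h
  exact .and (.ratLT (hf.relComputable.comp (hb.pair (hi.pair hl))) (.const 1) (h2 hl) (.const 2)
      (h2 hk))
    (.ratLT (hf.relComputable.comp (hb.pair (.pair (.comp .oracle (.mul (.const 2) hl)) hl)))
      (.const 2) (h2 hl) (.add (.mul (.const 3) hA) (.const 2))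
      (.mul (.const 3) (.stageDenom hz.fst.fst hz.fst.snd.fst)))

theorem relComputable_farName (hf : Computable f) : RelComputable (farName f) := by
  have hz : RelComputable fun _ (z : (ℕ × ℕ × ℕ) × ℕ) => z := .id
  have hv := (Primrec.ofNat (List ℕ)).relComputable.comp hz.snd
  have hlen := Primrec.list_length.relComputable.comp hv
  have hl := Primrec.pred.relComputable.comp hlen
  exact .cond (.and (.lt (.const 0) hlen) ((relComputable_farTest hf).comp
    (hz.fst.pair (.pair (Primrec.list_getI.relComputable hv hl) hl))))
    (hz.snd.add (.const 1)) (.const 0)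

theorem relComputable_coverTest (hf : Computable f) : RelComputable (coverTest f) := by
  have hz : RelComputable fun _ (z : (ℕ × ℕ × ℕ) × ℕ × ℕ) => z := .id
  have hw := (RelComputable.word (relComputable_farName hf)).comp (hz.fst.pair hz.snd.snd)
  have he := Primrec.encode.relComputable.comp hw
  have hp := RelComputable.oracle.comp (.add (.mul (.const 4) hz.snd.fst) (.const 3))
  exact (hp.eq (he.add (.const 1))).of_eq fun p z => rfl

theorem relPartrec_stageStep (hf : Computable f) : RelPartrec (stageStep f) := by
  have hz : RelComputable fun _ (z : (ℕ × ℕ × ℕ) × ℕ) => z := .id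
  have hu := hz.fst.pair (Primrec.unpair.relComputable.comp hz.snd)
  have hn := (relComputable_nearTest hf).comp hu
  have hA := RelComputable.mul (.const 3) hz.fst.snd.snd
  exact RelPartrec.map (.rfind (.or hn ((relComputable_coverTest hf).comp hu)))
    (.cond hn (hA.add (.const 2)) hA)

theorem oracleComputable_niceRadiusMachine (hf : Computable f) :
    OracleComputable (niceRadiusMachine f) := by
  refine RelPartrec.oracleComputable ?_
  have hz : RelComputable fun _ (z : ℕ × ℕ) => z := .id
  have hw : RelComputable fun _ (z : (ℕ × ℕ) × ℕ) => z := .id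
  have h2 := RelComputable.pow (.const 2) hz.snd
  have h1 : RelPartrec start := .rfind <| .ratGT
    (.comp .oracle (.add (.mul (.const 4) hz.snd) (.const 1))) (.const 1) h2 (.const 1) h2
  have h3 : RelPartrec (stage f) :=
    RelPartrec.nat_rec (RelComputable.const (α := ℕ) 1) (relPartrec_stageStep hf)
  have h4 : RelComputable fun _ => stageIndex :=
    Primrec₂.natPair.relComputable hw.snd (Primrec₂.natPair.relComputable (.const 0)
      (Primrec.pred.relComputable.comp (.stageDenom hw.fst.fst hw.fst.snd)))
  exact h1.bind ((h3.comp (hz.snd.pair hz.fst)).map (h4.comp ((hw.fst.snd.pair hw.fst.fst).pair hw.snd)))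

end
end CompAnalysis

/-! ### Correctness of the tests and of the trisection -/

namespace CompAnalysis
open Encodable RepresentedSpace

/-- A sphere is contained in the closure of the open ball as soon as, for every basic ball, the
doubled basic ball meets the open ball or the basic ball misses the sphere. -/
theorem closure_ball_eq_closedBall_of_dense {X : Type*} [MetricSpace X] {a : ℕ → X}
    (ha : DenseRange a) {x : X} {s : ℝ}
    (h : ∀ i k : ℕ, (∃ j, dist (a j) (a i) < 2 * (1 / 2 : ℝ) ^ k ∧ dist (a j) x < s) ∨
      ∀ y, dist y x = s → (1 / 2 : ℝ) ^ k < dist y (a i)) :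
    closure (Metric.ball x s) = Metric.closedBall x s := by
  refine Metric.closure_ball_subset_closedBall.antisymm fun y hy => ?_
  rcases (Metric.mem_closedBall.1 hy).lt_or_eq with hlt | heq
  · exact subset_closure hlt
  refine Metric.mem_closure_iff.2 fun ε hε => ?_
  obtain ⟨k, hk⟩ := exists_pow_lt_of_lt_one (show (0 : ℝ) < ε / 3 by positivity)
    (show (1 / 2 : ℝ) < 1 by norm_num)
  obtain ⟨i, hi⟩ := ha.exists_dist_lt y (show (0 : ℝ) < (1 / 2 : ℝ) ^ k by positivity)
  rcases h i k with ⟨j, hj, hjx⟩ | h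
  · refine ⟨a j, hjx, ?_⟩
    have := dist_triangle_right y (a j) (a i)
    linarith
  · exact absurd (h y heq) (not_lt.2 hi.le)

theorem one_div_two_pow (k : ℕ) : (1 : ℝ) / ((2 ^ k : ℕ) : ℝ) = (1 / 2 : ℝ) ^ k := by
  push_cast
  rw [one_div_pow]

theorem div_two_pow (c : ℝ) (k : ℕ) : c / ((2 ^ k : ℕ) : ℝ) = c * (1 / 2 : ℝ) ^ k := by
  rw [← one_div_two_pow, mul_one_div]

theorem exists_mul_half_pow_lt {c ε : ℝ} (hc : 0 < c) (hε : 0 < ε) :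
    ∃ l : ℕ, c * (1 / 2 : ℝ) ^ l < ε := by
  obtain ⟨l, hl⟩ := exists_pow_lt_of_lt_one (div_pos hε hc) (show (1 / 2 : ℝ) < 1 by norm_num)
  exact ⟨l, by rwa [lt_div_iff₀' hc] at hl⟩

theorem stageDenom_pos (e t : ℕ) : 0 < stageDenom e t := by
  unfold stageDenom; positivity

section
variable {X : Type*} [MetricSpace X] [ComputableMetricSpace X]

local notation "pt" => (ComputableMetricSpace.pt : ℕ → X)

/-- The points of which `farTest` certifies that they are far from the `i`-th dense point or from
the centre `x`. -/
def farSet (x : X) (P : ℕ × ℕ × ℕ) : Set X :=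
  {y | (1 / 2 : ℝ) ^ P.2.1.unpair.2 < dist y (pt P.2.1.unpair.1) ∨
    (3 * P.2.2 + 1 : ℝ) / (3 * stageDenom P.1 P.2.1) < dist y x}

/-- Some dense point is near the `i`-th dense point and near the centre `x`. -/
def HasNear (x : X) (P : ℕ × ℕ × ℕ) : Prop :=
  ∃ j, dist (pt j) (pt P.2.1.unpair.1) < 2 * (1 / 2 : ℝ) ^ P.2.1.unpair.2 ∧
    dist (pt j) x < (3 * P.2.2 + 2 : ℝ) / (3 * stageDenom P.1 P.2.1)

theorem isName_cauchy {p : ℕ → ℕ} {x : X} :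
    IsName p x ↔ ∀ k, dist (pt (p k)) x < (1 / 2 : ℝ) ^ k := Iff.rfl

theorem isName_real {p : ℕ → ℕ} {x : ℝ} :
    IsName p x ↔ ∀ k, |ratSeq (p k) - x| < (1 / 2 : ℝ) ^ k := Iff.rfl

variable (X) in
/-- `f` computes the double sequence of distances of the dense points. -/
def IsDistName (f : ℕ × ℕ × ℕ → ℕ) : Prop :=
  ∀ i j : ℕ, IsName (fun k => f (i, j, k))
    (dist (ComputableMetricSpace.pt i : X) (ComputableMetricSpace.pt j))

variable {f : ℕ × ℕ × ℕ → ℕ} {p : ℕ → ℕ} {x : X}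

theorem farTest_iff {P : ℕ × ℕ × ℕ} {b l : ℕ} :
    farTest f p (P, b, l) = true ↔
      (1 / 2 : ℝ) ^ P.2.1.unpair.2 + 3 * (1 / 2 : ℝ) ^ l < ratSeq (f (b, P.2.1.unpair.1, l)) ∨
      (3 * P.2.2 + 1 : ℝ) / (3 * stageDenom P.1 P.2.1) + 3 * (1 / 2 : ℝ) ^ l <
        ratSeq (f (b, p (2 * l), l)) := by
  have hD := stageDenom_pos P.1 P.2.1
  rw [farTest, Bool.or_eq_true, ratGT_iff (by positivity) (by positivity),
    ratGT_iff (by positivity) (by positivity), div_two_pow, div_two_pow]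
  push_cast
  rw [one_mul]

theorem nearTest_iff {P : ℕ × ℕ × ℕ} {b l : ℕ} :
    nearTest f p (P, b, l) = true ↔
      ratSeq (f (b, P.2.1.unpair.1, l)) + (1 / 2 : ℝ) ^ l < 2 * (1 / 2 : ℝ) ^ P.2.1.unpair.2 ∧
      ratSeq (f (b, p (2 * l), l)) + 2 * (1 / 2 : ℝ) ^ l <
        (3 * P.2.2 + 2 : ℝ) / (3 * stageDenom P.1 P.2.1) := by
  have hD := stageDenom_pos P.1 P.2.1
  rw [nearTest, Bool.and_eq_true, ratLT_iff (by positivity) (by positivity),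
    ratLT_iff (by positivity) (by positivity), div_two_pow, div_two_pow, div_two_pow]
  push_cast
  rw [one_mul]

/-- The margin `3 · 2⁻ˡ` covers the errors of the computed distance, of `b` as an approximation of
`y`, and of the approximate centre; the first alternative needs only two of these. -/
theorem mem_farSet_of_farTest (hf : IsDistName X f)
    (hx : IsName (fun n => p (2 * n)) x) {P : ℕ × ℕ × ℕ} {b l : ℕ} (h : farTest f p (P, b, l) = true) {y : X}
    (hy : dist (pt b) y < (1 / 2 : ℝ) ^ l) : y ∈ farSet x P := by
  have h1 := fun j => abs_lt.1 (isName_real.1 (hf b j) l)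
  have h2 := isName_cauchy.1 hx l
  refine (farTest_iff.1 h).imp (fun h => ?_) fun h => ?_
  · have h3 := (h1 P.2.1.unpair.1).2
    have h4 := dist_triangle_left y (pt P.2.1.unpair.1) (pt b)
    have h5 := dist_triangle (pt b) y (pt P.2.1.unpair.1)
    linarith [dist_nonneg (x := pt b) (y := y)]
  · have h3 := (h1 (p (2 * l))).2
    have h4 := dist_triangle4 (pt b) y x (pt (p (2 * l)))
    rw [dist_comm x] at h4
    linarith

theorem exists_farTest (hf : IsDistName X f)
    (hx : IsName (fun n => p (2 * n)) x) {P : ℕ × ℕ × ℕ} {y : X} (hy : y ∈ farSet x P) {q : ℕ → ℕ}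
    (hq : IsName q y) : ∃ l, farTest f p (P, q l, l) = true := by
  have hq := isName_cauchy.1 hq
  have h1 := fun b j l => abs_lt.1 (isName_real.1 (hf b j) l)
  have h2 := isName_cauchy.1 hx
  rcases hy with hy | hy
  -- The constant is the margin 3 plus the two approximation errors; the other case has three
  -- errors, hence 6.
  · obtain ⟨l, hl⟩ := exists_mul_half_pow_lt (show (0 : ℝ) < 5 by norm_num) (sub_pos.2 hy)
    refine ⟨l, farTest_iff.2 (.inl ?_)⟩
    have h3 := (h1 (q l) P.2.1.unpair.1 l).1
    have h4 := dist_triangle_left y (pt P.2.1.unpair.1) (pt (q l))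
    linarith [hq l]
  · obtain ⟨l, hl⟩ := exists_mul_half_pow_lt (show (0 : ℝ) < 6 by norm_num) (sub_pos.2 hy)
    refine ⟨l, farTest_iff.2 (.inr ?_)⟩
    have h3 := (h1 (q l) (p (2 * l)) l).1
    have h4 := dist_triangle4 y (pt (q l)) (pt (p (2 * l))) x
    rw [dist_comm y (pt (q l))] at h4
    linarith [hq l, h2 l]

theorem hasNear_of_nearTest (hf : IsDistName X f)
    (hx : IsName (fun n => p (2 * n)) x) {P : ℕ × ℕ × ℕ} {b l : ℕ} (h : nearTest f p (P, b, l) = true) :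
    HasNear x P := by
  have h1 := fun j => abs_lt.1 (isName_real.1 (hf b j) l)
  have h2 := isName_cauchy.1 hx l
  obtain ⟨h3, h4⟩ := nearTest_iff.1 h
  refine ⟨b, ?_, ?_⟩
  · linarith [(h1 P.2.1.unpair.1).1]
  · linarith [(h1 (p (2 * l))).1, dist_triangle (pt b) (pt (p (2 * l))) x]

theorem exists_nearTest (hf : IsDistName X f)
    (hx : IsName (fun n => p (2 * n)) x) {P : ℕ × ℕ × ℕ} (h : HasNear x P) :
    ∃ b l, nearTest f p (P, b, l) = true := by
  obtain ⟨b, hb, hb'⟩ := h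
  -- The constant 4 is the margin 2 of the centre test plus its two approximation errors; the other
  -- test needs only 2.
  obtain ⟨l, hl⟩ := exists_mul_half_pow_lt (show (0 : ℝ) < 4 by norm_num)
    (lt_min (sub_pos.2 hb) (sub_pos.2 hb'))
  obtain ⟨hl1, hl2⟩ := lt_min_iff.1 hl
  have hpos : (0 : ℝ) < (1 / 2) ^ l := by positivity
  refine ⟨b, l, nearTest_iff.2 ⟨?_, ?_⟩⟩
  · have h3 := (abs_lt.1 (isName_real.1 (hf b P.2.1.unpair.1) l)).2
    linarith
  · have h3 := (abs_lt.1 (isName_real.1 (hf b (p (2 * l))) l)).2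
    have h4 := dist_triangle_right (pt b) (pt (p (2 * l))) x
    linarith [isName_cauchy.1 hx l]

/-- The last letter of a prefix of length `l + 1` is the index of a dense point within `2⁻ˡ` of the
named point, so testing that letter at precision `l` is sound for every point whose name has this
prefix, and some prefix passes for each point of the set. -/
theorem isOpenName_farName (hf : IsDistName X f)
    (hx : IsName (fun n => p (2 * n)) x) (P : ℕ × ℕ × ℕ) :
    IsOpenName (fun j => farName f p (P, j)) (farSet x P) := by
  intro q y hq
  have key : ∀ k, farName f p (P, encode (word q (k + 1))) =
      bif farTest f p (P, q k, k) then encode (word q (k + 1)) + 1 else 0 := fun k => by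
    simp [farName, word, List.getI]
  constructor
  · intro hy
    obtain ⟨l, hl⟩ := exists_farTest hf hx hy hq
    exact ⟨encode (word q (l + 1)), l + 1, (key l).trans (by rw [hl, cond_true])⟩
  · rintro ⟨n, k, h⟩
    -- A word can only be listed at its own code.
    have hn : n = encode (word q k) := by
      simp only [farName, Bool.cond_eq_ite] at h
      split_ifs at h
      omega
    subst hn
    cases k with
    | zero =>
      have h : farName f p (P, encode (word q 0)) = _ := h
      simp [farName, word] at h
    | succ k =>
      replace h := (key k).symm.trans h
      have hk : farTest f p (P, q k, k) = true := by
        by_contra hk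
        rw [Bool.not_eq_true] at hk
        rw [hk, cond_false] at h
        exact absurd h (Nat.succ_ne_zero _).symm
      exact mem_farSet_of_farTest hf hx hk (isName_cauchy.1 hq k)

/-- The name of `K` lists prefixes of names of its open neighbourhoods; it is applied to the
particular name `farName`. -/
theorem subset_farSet_iff (hf : IsDistName X f)
    (hx : IsName (fun n => p (2 * n)) x) {K : CompactSets X} (hK : IsName (fun n => p (4 * n + 3)) K)
    (P : ℕ × ℕ × ℕ) : K.1 ⊆ farSet x P ↔ ∃ n k, coverTest f p (P, n, k) = true := by
  have hU := isOpenName_farName hf hx P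
  refine (hK _ (⟨farSet x P, _, hU⟩ : OpenSets X) hU).trans ?_
  simp [coverTest]

theorem exists_stageTest (hf : IsDistName X f)
    (hx : IsName (fun n => p (2 * n)) x) {K : CompactSets X} (hK : IsName (fun n => p (4 * n + 3)) K)
    (P : ℕ × ℕ × ℕ) : ∃ m, stageTest f p (P, m) = true := by
  by_cases h : HasNear x P
  · obtain ⟨b, l, h⟩ := exists_nearTest hf hx h
    exact ⟨Nat.pair b l, by simp [stageTest, h]⟩
  -- A point outside the far set is within `2⁻ᵏ` of `aᵢ` and within the first division point of `x`.
  -- A dense point close enough to it, the gap between the division points being positive, would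
  -- witness `HasNear`.
  · have hsub : K.1 ⊆ farSet x P := fun y _ => by
      by_contra hy
      have hD : (0 : ℝ) < 3 * stageDenom P.1 P.2.1 := by
        have := stageDenom_pos P.1 P.2.1
        positivity
      simp only [farSet, Set.mem_ofPred_eq, not_or, not_lt] at hy
      have hlt : (3 * P.2.2 + 1 : ℝ) / (3 * stageDenom P.1 P.2.1) <
          (3 * P.2.2 + 2 : ℝ) / (3 * stageDenom P.1 P.2.1) := by gcongr; norm_num
      have hpos : (0 : ℝ) < (1 / 2) ^ P.2.1.unpair.2 := by positivity
      obtain ⟨j, hj⟩ := ComputableMetricSpace.dense.exists_dist_lt y (lt_min hpos (sub_pos.2 hlt))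
      obtain ⟨hj1, hj2⟩ := lt_min_iff.1 hj
      refine h ⟨j, ?_, ?_⟩
      · linarith [dist_triangle_left (pt j) (pt P.2.1.unpair.1) y]
      · linarith [dist_triangle_left (pt j) x y]
    obtain ⟨n, k, h⟩ := (subset_farSet_iff hf hx hK P).1 hsub
    exact ⟨Nat.pair n k, by simp [stageTest, h]⟩

theorem of_mem_stageStep (hf : IsDistName X f)
    (hx : IsName (fun n => p (2 * n)) x) {K : CompactSets X} (hK : IsName (fun n => p (4 * n + 3)) K)
    {P : ℕ × ℕ × ℕ} {B : ℕ} (h : B ∈ stageStep f p P) :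
    (B = 3 * P.2.2 + 2 ∧ HasNear x P) ∨ (B = 3 * P.2.2 ∧ K.1 ⊆ farSet x P) := by
  obtain ⟨m, hm, rfl⟩ := (Part.mem_map_iff _).1 h
  have hm : stageTest f p (P, m) = true := by simpa using (Nat.mem_rfind.1 hm).1
  -- Both conditions may hold; the choice follows the test that succeeds at the `m` found, with
  -- `nearTest` taking precedence.
  by_cases hn : nearTest f p (P, m.unpair) = true
  · exact .inl ⟨by simp [stageNext, hn], hasNear_of_nearTest hf hx hn⟩
  · have hc : coverTest f p (P, m.unpair) = true := by simpa [stageTest, hn] using hm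
    exact .inr ⟨by simp [stageNext, hn], (subset_farSet_iff hf hx hK P).2 ⟨_, _, hc⟩⟩

theorem exists_stages (hf : IsDistName X f)
    (hx : IsName (fun n => p (2 * n)) x) {K : CompactSets X} (hK : IsName (fun n => p (4 * n + 3)) K) (e : ℕ) :
    ∃ A : ℕ → ℕ, A 0 = 1 ∧ ∀ t, A t ∈ stage f p (e, t) ∧
      ((A (t + 1) = 3 * A t + 2 ∧ HasNear x (e, t, A t)) ∨
        (A (t + 1) = 3 * A t ∧ K.1 ⊆ farSet x (e, t, A t))) := by
  have hex : ∀ t, ∃ B, B ∈ stage f p (e, t) := fun t => by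
    induction t with
    | zero => exact ⟨1, Part.mem_some _⟩
    | succ t ih =>
      obtain ⟨B, hB⟩ := ih
      obtain ⟨m, hm⟩ := exists_stageTest hf hx hK (e, t, B)
      obtain ⟨m, hm, -⟩ := Nat.rfind_min' (p := fun m => stageTest f p ((e, t, B), m)) hm
      exact ⟨_, Part.mem_bind hB (Part.mem_map _ hm)⟩
  choose A hA using hex
  refine ⟨A, Part.mem_some_iff.1 (hA 0), fun t => ⟨hA t, ?_⟩⟩
  obtain ⟨B, hB, h⟩ := Part.mem_bind_iff.1 (hA (t + 1))
  rw [Part.mem_unique hB (hA t)] at h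
  exact of_mem_stageStep hf hx hK h

theorem exists_mem_start {r : ℝ} (hr : 0 < r) (h : IsName (fun n => p (4 * n + 1)) r) :
    ∃ e, (∀ n, e ∈ start p n) ∧ (1 / 2 : ℝ) ^ e < r := by
  have h1 := fun n => abs_lt.1 (isName_real.1 h n)
  have hiff : ∀ n m, startTest p (n, m) = true ↔
      (1 / 2 : ℝ) ^ m + (1 / 2) ^ m < ratSeq (p (4 * m + 1)) := fun n m => by
    rw [startTest, ratGT_iff (by positivity) (by positivity), div_two_pow]
    push_cast
    rw [one_mul]
  obtain ⟨m, hm⟩ := exists_mul_half_pow_lt (show (0 : ℝ) < 3 by norm_num) hr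
  obtain ⟨e, he, -⟩ := Nat.rfind_min' (p := fun m => startTest p (0, m))
    ((hiff 0 m).2 (by linarith [(h1 m).1]))
  -- `startTest` ignores the output position, so all output digits use the same start interval.
  refine ⟨e, fun _ => he, ?_⟩
  have := (hiff 0 e).1 (by simpa using (Nat.mem_rfind.1 he).1)
  linarith [(h1 e).2]

theorem ratSeq_stageIndex (e n A : ℕ) :
    ratSeq (stageIndex ((e, n), A)) = A / stageDenom e n := by
  have : ((stageDenom e n - 1 : ℕ) : ℝ) + 1 = stageDenom e n := by
    exact_mod_cast Nat.sub_add_cancel (stageDenom_pos e n)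
  simp [ratSeq, stageIndex, this]

/-- The nested intervals of the recursion have a common point. -/
theorem exists_mem_stages {e : ℕ} {A : ℕ → ℕ}
    (hA : ∀ t, A (t + 1) = 3 * A t + 2 ∨ A (t + 1) = 3 * A t) :
    ∃ s : ℝ, ∀ t, (A t : ℝ) / stageDenom e t ≤ s ∧ s ≤ (A t + 1 : ℝ) / stageDenom e t := by
  have hD : ∀ t, (0 : ℝ) < stageDenom e t := fun t => by exact_mod_cast stageDenom_pos e t
  have hS : ∀ t, (stageDenom e (t + 1) : ℝ) = stageDenom e t * 3 := fun t => by
    simp only [stageDenom]; push_cast; ring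
  have h := Monotone.ciSup_mem_iInter_Icc_of_antitone
    (f := fun t => (A t : ℝ) / stageDenom e t) (g := fun t => (A t + 1 : ℝ) / stageDenom e t)
    (monotone_nat_of_le_succ fun t => ?_) (antitone_nat_of_succ_le fun t => ?_) fun t => ?_
  · exact ⟨_, fun t => Set.mem_iInter.1 h t⟩
  · rw [hS, div_le_div_iff₀ (hD t) (by linarith [hD t])]
    have : (3 * A t : ℝ) ≤ A (t + 1) := by
      exact_mod_cast (by rcases hA t with h | h <;> omega : 3 * A t ≤ A (t + 1))
    nlinarith [hD t]
  · rw [hS, div_le_div_iff₀ (by linarith [hD t]) (hD t)]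
    have : (A (t + 1) : ℝ) ≤ 3 * A t + 2 := by
      exact_mod_cast (by rcases hA t with h | h <;> omega : A (t + 1) ≤ 3 * A t + 2)
    nlinarith [hD t]
  · have := hD t
    dsimp only
    gcongr
    linarith

end
end CompAnalysis

/-! ### The nice radius -/

open CompAnalysis RepresentedSpace in
theorem proposition20 {X : Type*} [MetricSpace X] [CompleteSpace X]
    [CompAnalysis.ComputableMetricSpace X] :
    (CompAnalysis.niceRadius X).IsComputable := by
  obtain ⟨f, hfc, hf⟩ := ComputableMetricSpace.computable_dist (X := X)
  refine ⟨niceRadiusMachine f, oracleComputable_niceRadiusMachine hfc, ?_⟩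
  rintro ⟨x, ⟨r, hr⟩, K⟩ hdom p ⟨hx, hrK⟩
  change K.1 = Metric.closedBall x r at hdom
  -- Nested interleaving puts `x` at the positions `2n`, `r` at `4n + 1` and `K` at `4n + 3`.
  have hr' : IsName (fun n => p (4 * n + 1)) r := by
    have : IsName (fun n => p (2 * (2 * n) + 1)) r := hrK.1
    simpa only [← mul_assoc, Nat.reduceMul] using this
  have hK : IsName (fun n => p (4 * n + 3)) K := by
    have : IsName (fun n => p (2 * (2 * n + 1) + 1)) K := hrK.2
    simpa only [show ∀ n, 2 * (2 * n + 1) + 1 = 4 * n + 3 by intro n; ring] using this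
  obtain ⟨e, he, her⟩ := exists_mem_start hr hr'
  obtain ⟨A, hA0, hA⟩ := exists_stages hf hx hK e
  obtain ⟨s, hs⟩ := exists_mem_stages (e := e) fun t => (hA t).2.imp And.left And.left
  have hD : ∀ t, (0 : ℝ) < stageDenom e t := fun t => by exact_mod_cast stageDenom_pos e t
  have hS : ∀ t, (stageDenom e (t + 1) : ℝ) = 3 * stageDenom e t := fun t => by
    simp only [stageDenom]; push_cast; ring
  have hs0 := hs 0
  rw [hA0] at hs0
  have hpos : 0 < s := lt_of_lt_of_le (div_pos (by norm_num) (hD 0)) hs0.1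
  have hlt : s < r := by
    -- The start interval runs from `2⁻ᵉ / 3` to `2 · 2⁻ᵉ / 3`, and `2⁻ᵉ < r`.
    refine hs0.2.trans_lt (lt_of_le_of_lt ?_ her)
    have h2 : (0 : ℝ) < 2 ^ e := by positivity
    simp only [stageDenom]
    push_cast
    rw [one_div_pow, div_le_div_iff₀ (by positivity) h2]
    linarith
  refine ⟨fun n => stageIndex ((e, n), A n), s, fun n => ?_, ?_, hpos, hlt, ?_⟩
  · exact Part.mem_bind (he n) (Part.mem_map _ (hA n).1)
  · refine isName_real.2 fun n => ?_
    rw [ratSeq_stageIndex, abs_sub_comm, abs_of_nonneg (sub_nonneg.2 (hs n).1)]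
    have h1 : s - A n / stageDenom e n ≤ 1 / stageDenom e n := by
      have := (hs n).2
      rw [add_div] at this
      linarith
    refine h1.trans_lt ?_
    rw [one_div_pow]
    refine one_div_lt_one_div_of_lt (by positivity) ?_
    have h2 : 2 ^ n < stageDenom e n := calc
      2 ^ n ≤ 3 ^ n := Nat.pow_le_pow_left (by norm_num) n
      _ < 3 ^ (n + 1) := Nat.pow_lt_pow_right (by norm_num) (Nat.lt_succ_self n)
      _ ≤ stageDenom e n := Nat.le_mul_of_pos_left _ (by positivity)
    exact_mod_cast h2
  · refine closure_ball_eq_closedBall_of_dense ComputableMetricSpace.dense fun i k => ?_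
    -- The pair `(i, k)` is treated at the stage it codes; the next interval records the choice.
    have hs' := hs (Nat.pair i k + 1)
    rcases (hA (Nat.pair i k)).2 with ⟨hB, j, hj, hjx⟩ | ⟨hB, hsub⟩
    · refine .inl ⟨j, by simpa using hj, hjx.trans_le ?_⟩
      rw [hB, hS] at hs'
      push_cast at hs'
      exact hs'.1
    · refine .inr fun y hy => ?_
      have hyK : y ∈ K.1 := by
        rw [hdom, Metric.mem_closedBall, hy]
        exact hlt.le
      rw [hB, hS] at hs'
      push_cast at hs'
      rcases hsub hyK with h | h
      · simpa using h
      · exact absurd (h.trans_eq hy) (not_lt.2 hs'.2)
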